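/- Entourages of a uniformity are taken to be symmetric, and a uniformity is assumed to be separated (the intersection of all its entourages is the diagonal). For $A,B\subset X\times X$ put $A\circ B=\{(x,y): (x,z)\in A \text{ and } (z,y)\in B\text{ for some } z\in X\}$. (a) A topological space $X$ can be embedded (as a topological subspace) in a metrizable topological group $G$ with $\operatorname{ind} G=0$ if and only if the topology of $X$ is generated by a uniformity which has a countable base consisting of open-and-closed subsets of $X\times X$. (b) Let the topology of $X$ be generated by a uniformity with a base $\{\mathcal W_i: i\ge 0\}$ of clopen entourages. Then there are sequences $\mathcal V_0,\mathcal V_1,\dots$ of clopen entourages such that $\mathcal V_0=X\times X$ and, for all $i\ge 0$, $\mathcal V_{i+1}\circ\mathcal V_{i+1}\circ\mathcal V_{i+1}\subset\mathcal V_i$ and $\mathcal V_{i+1}\subset \mathcal W_i$. For every such sequence, put $\mathcal U_i=\mathcal V_{i^2}$. Then the sets $$W_n(\boldsymbol{\mathcal U})=\bigcup_{k\ge 0}\Bigl\{\sum_{i=1}^k(x_i-y_i): x_i,y_i\in X,\ (x_i,y_i)\in\mathcal U_{n\cdot i}\text{ for } 1\le i\le k\Bigr\},\qquad n=0,1,2,\dots,$$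 form a neighborhood base at zero for a group topology $\mathcal T_{\boldsymbol{\mathcal U}}$ on the free Abelian group $A(X)$; this topology is metrizable and has a base of clopen sets (so $\operatorname{ind}(A(X),\mathcal T_{\boldsymbol{\mathcal U}})=0$), and the canonical map $X\to A(X)$ is a homeomorphism of $X$ onto a closed subspace of $(A(X),\mathcal T_{\boldsymbol{\mathcal U}})$. -/

import Mathlib

open Filter Topology
open scoped Uniformity SetRel

universe u

/-- `W 0, W 1, …` is a (countable) base of the uniformity of `X`, which is separated (the
intersection of all entourages is the diagonal), and consists of symmetric entourages that are
open-and-closed in `X × X`. -/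
structure IsClopenUniformBase {X : Type*} [UniformSpace X] (W : ℕ → SetRel X X) : Prop where
  hasBasis : (𝓤 X).HasBasis (fun _ : ℕ => True) W
  separated : ∀ x y : X, (∀ n, (x, y) ∈ W n) → x = y
  symm : ∀ n, (W n).IsSymm
  clopen : ∀ n, IsClopen (W n)

/-- The topology of `X` is generated by a separated uniformity that has a countable base
consisting of open-and-closed sets. -/
def HasClopenUniformity (X : Type*) [t : TopologicalSpace X] : Prop :=
  ∃ u : UniformSpace X, u.toTopologicalSpace = t ∧
    ∃ W : ℕ → SetRel X X, @IsClopenUniformBase X u W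

/-- `V 0, V 1, …` is a sequence of symmetric clopen entourages subordinate to the base `W`:
`V 0 = X × X`, the threefold composition of `V (i + 1)` is contained in `V i`, and
`V (i + 1)` is contained in `W i`. -/
structure IsSubordinate {X : Type*} [UniformSpace X] (W V : ℕ → SetRel X X) : Prop where
  zero : V 0 = Set.univ
  mem : ∀ i, V i ∈ 𝓤 X
  symm : ∀ i, (V i).IsSymm
  clopen : ∀ i, IsClopen (V i)
  comp : ∀ i, V (i + 1) ○ V (i + 1) ○ V (i + 1) ⊆ V i
  subset : ∀ i, V (i + 1) ⊆ W i

/-- The set of all sums `∑ (x_i - y_i)` over `1 ≤ i ≤ k` (with `k ≥ 0` arbitrary) in the free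
Abelian group on `X` such that `(x_i, y_i) ∈ U (n * i)` for every `i`. The index `i : Fin k`
below stands for `i + 1`. -/
def wordSet {X : Type*} (U : ℕ → SetRel X X) (n : ℕ) : Set (FreeAbelianGroup X) :=
  {g | ∃ (k : ℕ) (x y : Fin k → X), (∀ i : Fin k, (x i, y i) ∈ U (n * (i + 1))) ∧
    g = ∑ i : Fin k, (FreeAbelianGroup.of (x i) - FreeAbelianGroup.of (y i))}

/-! Turn entourages into costs. Let `c x y = (1/2)^N`, where `N` is the first index with `(x, y) ∉ V
N` (and `0` if there is none). The chain condition on `V` gives, by Frink's metrization argument, a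
metric with `dist ≤ c ≤ 2 * dist`; clopenness makes `c` locally constant off the diagonal
(`IsGauge`). The `n`-th neighborhood of zero then consists of the words whose `i`-th pair costs less
than `(1/2)^((n * i)^2)`, and the group axioms reduce to counting expensive pairs.

The difficulty is to find clopen sets. Inside each neighborhood, keep the elements having a stable
matching (in the stable-marriage sense) whose costs fit the slots: `stableWords`. Testing against
1-Lipschitz functions shows that the costs of a stable matching are almost as small as those of any
matching of the same element (`hasTail_of_stable`). So if `g = ∑ (u i - v i)` is reduced and `w` is
small enough, every stable matching of `g + w` has as many large pairs as `g`, with letters near the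
`u i` and `v i`, and all other pairs are tiny (`exists_perturbation_bound`). Local constancy of `c`
then transports matchings between `g` and `g + w` at equal cost, in both directions; hence
`stableWords` is clopen, and its translates form a base.

Conversely, a clopen base at the identity of a metrizable group yields clopen entourages of the left
uniformity, which restrict to `X`. -/

/-! ### Matchings of words and their stability. -/

section StableMatching

variable {X ι κ : Type*} [Fintype ι] [Fintype κ]

/-- The element `∑ (x i - y i)` of the free abelian group. -/
noncomputable def pairSum (x y : ι → X) : FreeAbelianGroup X :=
  ∑ i, (FreeAbelianGroup.of (x i) - FreeAbelianGroup.of (y i))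

/-- A matching `x i ↔ y i` is stable for the cost `c` if no `x i` and `y j` are closer to each
other than both are to their partners. -/
def IsStable (c : X → X → ℝ) (x y : ι → X) : Prop :=
  ∀ i j, min (c (x i) (y i)) (c (x j) (y j)) ≤ c (x i) (y j)

open Classical in
/-- All but `r` of the costs `a i` add up to at most `θ`. -/
def HasTail (a : ι → ℝ) (r : ℕ) (θ : ℝ) : Prop :=
  ∃ J : Finset ι, J.card ≤ r ∧ ∑ i ∈ Jᶜ, a i ≤ θ

theorem hasTail_iff [DecidableEq ι] {a : ι → ℝ} {r : ℕ} {θ : ℝ} :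
    HasTail a r θ ↔ ∃ J : Finset ι, J.card ≤ r ∧ ∑ i ∈ Jᶜ, a i ≤ θ := by
  unfold HasTail
  convert Iff.rfl

theorem lift_pairSum (f : X → ℝ) (x y : ι → X) :
    FreeAbelianGroup.lift f (pairSum x y) = ∑ i, (f (x i) - f (y i)) := by
  simp [pairSum, map_sum]

theorem pairSum_swap (x y : ι → X) : pairSum y x = -pairSum x y := by
  simp [pairSum]

theorem pairSum_comp_equiv (e : κ ≃ ι) (x y : ι → X) :
    pairSum (x ∘ e) (y ∘ e) = pairSum x y :=
  e.sum_comp fun i => FreeAbelianGroup.of (x i) - FreeAbelianGroup.of (y i)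

theorem pairSum_comp_right (e : Equiv.Perm ι) (x y : ι → X) :
    pairSum x (y ∘ e) = pairSum x y := by
  rw [pairSum, pairSum, Finset.sum_sub_distrib, Finset.sum_sub_distrib]
  congr 1
  exact Equiv.sum_comp e fun i => FreeAbelianGroup.of (y i)

theorem pairSum_sumElim (x y : ι → X) (a b : κ → X) :
    pairSum (Sum.elim x a) (Sum.elim y b) = pairSum x y + pairSum a b := by
  simp only [pairSum, Fintype.sum_sum_type, Sum.elim_inl, Sum.elim_inr]

open Classical in
theorem HasTail.card_lt_le {a : ι → ℝ} {r : ℕ} {θ t : ℝ} (ha : ∀ i, 0 ≤ a i) (h : HasTail a r θ)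
    (ht : θ < t) : (Finset.univ.filter fun i => t ≤ a i).card ≤ r := by
  obtain ⟨J, hJ, hs⟩ := h
  refine (Finset.card_le_card fun i hi => ?_).trans hJ
  by_contra hiJ
  have := Finset.single_le_sum (f := a) (fun j _ => ha j) (Finset.mem_compl.2 hiJ)
  have := (Finset.mem_filter.1 hi).2
  linarith

theorem HasTail.sumElim {a : ι → ℝ} {b : κ → ℝ} {r : ℕ} {θ : ℝ} (h : HasTail b r θ) :
    HasTail (Sum.elim a b) (Fintype.card ι + r) θ := by
  classical
  obtain ⟨J, hJ, hs⟩ := h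
  refine hasTail_iff.2 ⟨Finset.univ.disjSum J, by simpa using hJ, ?_⟩
  have : (Finset.univ.disjSum J : Finset (ι ⊕ κ))ᶜ = (∅ : Finset ι).disjSum Jᶜ := by
    ext (i | i) <;> simp
  rw [this]
  simpa using hs

/-- Weight each pair by `3 ^ R`, with `R` larger for cheaper pairs, and maximize the total weight.
If `x i` and `y (σ j)` violated stability, swapping partners would create a pair weighing at least
three times either of the two old ones, hence more than both together. -/
theorem exists_stable_permutation (c : X → X → ℝ) (x y : ι → X) :
    ∃ σ : Equiv.Perm ι, IsStable c x (y ∘ σ) := by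
  classical
  set R : ℝ → ℕ := fun v => (Finset.univ.filter fun p : ι × ι => v < c (x p.1) (y p.2)).card
    with hR
  have hRlt : ∀ v i j, v < c (x i) (y j) → R (c (x i) (y j)) < R v := by
    intro v i j h
    refine Finset.card_lt_card (Finset.ssubset_iff_of_subset ?_ |>.2 ⟨(i, j), by simpa using h,
      by simp⟩)
    intro p hp
    simp only [Finset.mem_filter, Finset.mem_univ, true_and] at hp ⊢
    exact h.trans hp
  set F : Equiv.Perm ι → ℕ := fun σ => ∑ i, 3 ^ R (c (x i) (y (σ i))) with hF
  obtain ⟨σ, hσ⟩ := Finite.exists_max F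
  refine ⟨σ, fun i j => ?_⟩
  by_contra! hlt
  simp only [Function.comp, lt_min_iff] at hlt
  obtain ⟨h1, h2⟩ := hlt
  have hij : i ≠ j := by
    rintro rfl
    exact lt_irrefl _ h1
  have hsum : ∀ τ : Equiv.Perm ι, F τ = 3 ^ R (c (x i) (y (τ i))) + (3 ^ R (c (x j) (y (τ j)))
      + ∑ k ∈ (Finset.univ.erase i).erase j, 3 ^ R (c (x k) (y (τ k)))) := by
    intro τ
    rw [Finset.add_sum_erase _ (fun k => 3 ^ R (c (x k) (y (τ k)))) (by simp [hij.symm]),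
      Finset.add_sum_erase _ (fun k => 3 ^ R (c (x k) (y (τ k)))) (by simp)]
  have hle := hσ (σ * Equiv.swap i j)
  rw [hsum, hsum σ] at hle
  have heq : ∑ k ∈ (Finset.univ.erase i).erase j, 3 ^ R (c (x k) (y ((σ * Equiv.swap i j) k)))
      = ∑ k ∈ (Finset.univ.erase i).erase j, 3 ^ R (c (x k) (y (σ k))) := by
    refine Finset.sum_congr rfl fun k hk => ?_
    simp only [Finset.mem_erase] at hk
    rw [Equiv.Perm.mul_apply, Equiv.swap_apply_of_ne_of_ne hk.2.1 hk.1]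
  rw [heq] at hle
  simp only [Equiv.Perm.mul_apply, Equiv.swap_apply_left, Equiv.swap_apply_right] at hle
  have p1 : 3 * 3 ^ R (c (x i) (y (σ i))) ≤ 3 ^ R (c (x i) (y (σ j))) := by
    rw [← pow_succ']
    exact Nat.pow_le_pow_right (by norm_num) (hRlt _ _ _ h1)
  have p2 : 3 * 3 ^ R (c (x j) (y (σ j))) ≤ 3 ^ R (c (x i) (y (σ j))) := by
    rw [← pow_succ']
    exact Nat.pow_le_pow_right (by norm_num) (hRlt _ _ _ h2)
  have p3 : 0 < 3 ^ R (c (x i) (y (σ j))) := by positivity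
  have p4 : 0 < 3 ^ R (c (x j) (y (σ i))) := by positivity
  omega

end StableMatching

/-! ### Lipschitz test functions and the tails of stable matchings. -/

section Bump

variable {X ι κ : Type*} [MetricSpace X] [Fintype ι] [Fintype κ]

/-- The function is `max 0 (s - infDist · A)`. Extended to the free group, such functions bound
costs from below and count letters near `A`. -/
theorem exists_bump (A : Set X) {s : ℝ} (hs : 0 ≤ s) :
    ∃ f : X → ℝ, (∀ x y, f x - f y ≤ dist x y) ∧ (∀ x, 0 ≤ f x) ∧ (∀ x, f x ≤ s) ∧
      (∀ a ∈ A, f a = s) ∧ ∀ z, (∀ a ∈ A, s ≤ dist z a) → f z = 0 := by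
  rcases A.eq_empty_or_nonempty with rfl | hA
  · exact ⟨fun _ => 0, by simp, by simp, fun _ => hs, by simp, by simp⟩
  refine ⟨fun z => max 0 (s - Metric.infDist z A), fun x y => ?_, fun x => le_max_left _ _,
    fun x => ?_, fun a ha => ?_, fun z hz => ?_⟩
  · have := Metric.infDist_le_infDist_add_dist (s := A) (x := y) (y := x)
    rw [dist_comm] at this
    rcases max_cases (0 : ℝ) (s - Metric.infDist x A) with h | h <;>
    rcases max_cases (0 : ℝ) (s - Metric.infDist y A) with h' | h' <;>
    linarith [dist_nonneg (x := x) (y := y)]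
  · exact max_le hs (by linarith [Metric.infDist_nonneg (s := A) (x := x)])
  · simp [Metric.infDist_zero_of_mem ha, hs]
  · have := (Metric.le_infDist hA).2 hz
    exact max_eq_left (by linarith)

/-- A cost function on pairs of points, comparable with the distance and locally constant off the
diagonal. -/
structure IsGauge (c : X → X → ℝ) : Prop where
  symm : ∀ x y, c x y = c y x
  dist_le : ∀ x y, dist x y ≤ c x y
  le_dist : ∀ x y, c x y ≤ 2 * dist x y
  locallyConst : ∀ x y, x ≠ y → ∀ᶠ p : X × X in 𝓝 (x, y), c p.1 p.2 = c x y

namespace IsGauge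

variable {c : X → X → ℝ}

theorem nonneg (hc : IsGauge c) (x y : X) : 0 ≤ c x y := dist_nonneg.trans (hc.dist_le x y)

theorem self (hc : IsGauge c) (x : X) : c x x = 0 :=
  le_antisymm (by simpa using hc.le_dist x x) (hc.nonneg x x)

theorem pos (hc : IsGauge c) {x y : X} (h : x ≠ y) : 0 < c x y :=
  (dist_pos.2 h).trans_le (hc.dist_le x y)

open Classical in
/-- The costs of a stable matching are controlled by those of any other matching of the same
element. -/
theorem stable_cost_le (hc : IsGauge c) {x y : ι → X} {a b : κ → X}
    (hst : IsStable c x y) (heq : pairSum x y = pairSum a b) {t : ℝ} (B : Finset ι)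
    (hB : ∀ i ∈ B, t ≤ c (x i) (y i)) (ht : 0 ≤ t) (J : Finset κ) (hJ : J.card < B.card) :
    t ≤ 2 * (∑ i ∈ Bᶜ, c (x i) (y i) + ∑ j ∈ Jᶜ, c (a j) (b j)) := by
  -- Stability forces `c (x j) (y i) ≥ t` for all `i, j ∈ B`, so the distances are at least `t / 2`:
  -- a bump of that height is full on `x '' B` and vanishes on `y '' B`. The other matching gains at
  -- most `t / 2` from each pair in the smaller set `J`.
  obtain ⟨f, hfl, hf0, hfs, hfA, hfz⟩ := exists_bump (x '' B) (s := t / 2) (by linarith)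
  have h := congrArg (FreeAbelianGroup.lift f) heq
  rw [lift_pairSum, lift_pairSum, ← Finset.sum_add_sum_compl B, ← Finset.sum_add_sum_compl J] at h
  have h1 : ∑ i ∈ B, (f (x i) - f (y i)) = B.card * (t / 2) := by
    rw [← nsmul_eq_mul, ← Finset.sum_const]
    refine Finset.sum_congr rfl fun i hi => ?_
    rw [hfA _ ⟨i, hi, rfl⟩, hfz, sub_zero]
    rintro _ ⟨j, hj, rfl⟩
    have := hst j i
    have := hc.le_dist (x j) (y i)
    rw [dist_comm]
    have := le_min (hB j hj) (hB i hi)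
    linarith
  have h2 : -∑ i ∈ Bᶜ, c (x i) (y i) ≤ ∑ i ∈ Bᶜ, (f (x i) - f (y i)) := by
    rw [← Finset.sum_neg_distrib]
    refine Finset.sum_le_sum fun i _ => ?_
    have := hfl (y i) (x i)
    have := hc.dist_le (x i) (y i)
    rw [dist_comm] at this
    linarith
  have h3 : ∑ j ∈ J, (f (a j) - f (b j)) ≤ J.card * (t / 2) := by
    rw [← nsmul_eq_mul, ← Finset.sum_const]
    refine Finset.sum_le_sum fun j _ => ?_
    linarith [hf0 (b j), hfs (a j)]
  have h4 : ∑ j ∈ Jᶜ, (f (a j) - f (b j)) ≤ ∑ j ∈ Jᶜ, c (a j) (b j) :=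
    Finset.sum_le_sum fun j _ => (hfl _ _).trans (hc.dist_le _ _)
  have h5 : ((J.card : ℝ) + 1) * (t / 2) ≤ B.card * (t / 2) := by
    refine mul_le_mul_of_nonneg_right ?_ (by linarith)
    exact_mod_cast hJ
  linarith

/-- Downward induction on `r`, starting where every pair may be discarded. If the exceptional set
for `r + 1` is one too large, its cheapest pair is returned to the tail, at a price bounded by
`stable_cost_le`. -/
theorem hasTail_of_stable (hc : IsGauge c) {x y : ι → X} {a b : κ → X}
    (hst : IsStable c x y) (heq : pairSum x y = pairSum a b) {θ : ℕ → ℝ} (hθ0 : ∀ r, 0 ≤ θ r)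
    (hθ : ∀ r, 9 * θ (r + 1) ≤ θ r) {p : ℕ}
    (h : ∀ r, HasTail (fun j => c (a j) (b j)) (p + r) (θ r)) (r : ℕ) :
    HasTail (fun i => c (x i) (y i)) (p + r) (3 * θ r) := by
  classical
  obtain ⟨d, hd⟩ : ∃ d, Fintype.card ι ≤ d + r := ⟨Fintype.card ι, by omega⟩
  induction d generalizing r with
  | zero =>
    exact ⟨Finset.univ, by simpa using hd.trans (by omega), by simpa using hθ0 r⟩
  | succ d ih =>
    obtain ⟨J', hJ', hs'⟩ := ih (r + 1) (by omega)
    have hθr := hθ r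
    have hθr1 := hθ0 (r + 1)
    by_cases hcard : J'.card ≤ p + r
    · exact ⟨J', hcard, hs'.trans (by linarith)⟩
    push Not at hcard
    obtain ⟨i, hi, hmin⟩ := J'.exists_min_image (fun i => c (x i) (y i))
      (Finset.card_pos.1 (by omega))
    obtain ⟨J, hJ, hs⟩ := h r
    have := hc.stable_cost_le hst heq J' hmin (hc.nonneg _ _) J (by omega)
    -- The new tail is at most `3 θ (r+1) + 2 (3 θ (r+1) + θ r) = 9 θ (r+1) + 2 θ r ≤ 3 θ r`.
    refine ⟨J'.erase i, by rw [Finset.card_erase_of_mem hi]; omega, ?_⟩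
    rw [Finset.compl_erase, Finset.sum_insert (by simpa using hi)]
    linarith

end IsGauge

end Bump

/-! ### Slots and the neighborhoods of zero. -/

section Slots

variable {X ι κ : Type*} [Fintype ι] [Fintype κ]

/-- The bound on the cost of the pair in the slot with number `r + 1`. -/
noncomputable def slotBound (n r : ℕ) : ℝ := (1 / 2) ^ ((n * (r + 1)) ^ 2)

theorem slotBound_pos (n r : ℕ) : 0 < slotBound n r := by
  unfold slotBound
  positivity

theorem slotBound_le {n m r s : ℕ} (h : m * (s + 1) ≤ n * (r + 1)) :
    slotBound n r ≤ slotBound m s :=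
  pow_le_pow_of_le_one (by norm_num) (by norm_num) (Nat.pow_le_pow_left h 2)

theorem slotBound_anti {n r s : ℕ} (h : r ≤ s) : slotBound n s ≤ slotBound n r :=
  slotBound_le (Nat.mul_le_mul_left _ (by omega))

theorem slotBound_succ {n : ℕ} (hn : 1 ≤ n) (r : ℕ) :
    2 * slotBound n (r + 1) ≤ slotBound n r := by
  have : (1 / 2 : ℝ) ^ ((n * (r + 1 + 1)) ^ 2) ≤ (1 / 2) ^ ((n * (r + 1)) ^ 2 + 1) :=
    pow_le_pow_of_le_one (by norm_num) (by norm_num) (by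
      rw [mul_add n (r + 1) 1]
      nlinarith [Nat.zero_le (n * (r + 1))])
  rw [pow_succ _ ((n * (r + 1)) ^ 2)] at this
  unfold slotBound
  linarith

theorem slotBound_succ_of_two_le {n : ℕ} (hn : 2 ≤ n) (r : ℕ) :
    9 * slotBound n (r + 1) ≤ slotBound n r := by
  have : (1 / 2 : ℝ) ^ ((n * (r + 1 + 1)) ^ 2) ≤ (1 / 2) ^ ((n * (r + 1)) ^ 2 + 4) :=
    pow_le_pow_of_le_one (by norm_num) (by norm_num) (by
      rw [mul_add n (r + 1) 1]
      nlinarith [Nat.zero_le (n * (r + 1))])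
  rw [pow_add] at this
  have := slotBound_pos n r
  unfold slotBound at *
  linarith

theorem slotBound_lt_of_le {n m p : ℕ} (h : n * (p + 1) + 2 ≤ m) (r : ℕ) :
    6 * slotBound m r < slotBound n (p + r) := by
  have h1 : n * (p + r + 1) + 2 ≤ m * (r + 1) := by
    have := Nat.mul_le_mul_right (r + 1) h
    nlinarith [Nat.zero_le (n * (p * r))]
  have : (1 / 2 : ℝ) ^ ((m * (r + 1)) ^ 2) ≤ (1 / 2) ^ ((n * (p + r + 1)) ^ 2 + 4) :=
    pow_le_pow_of_le_one (by norm_num) (by norm_num) (by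
      nlinarith [Nat.pow_le_pow_left h1 2, Nat.zero_le (n * (p + r + 1))])
  rw [pow_add] at this
  have := slotBound_pos n (p + r)
  unfold slotBound at *
  linarith

theorem exists_slotBound_lt {η : ℝ} (hη : 0 < η) (N : ℕ) :
    ∃ m, N ≤ m ∧ 8 * slotBound m 0 < η := by
  obtain ⟨k, hk⟩ := exists_pow_lt_of_lt_one (show 0 < η / 8 by positivity)
    (show (1 / 2 : ℝ) < 1 by norm_num)
  refine ⟨max N k, le_max_left _ _, ?_⟩
  have h1 : k ≤ (max N k * (0 + 1)) ^ 2 := by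
    have : k ≤ max N k := le_max_right _ _
    nlinarith
  have : (1 / 2 : ℝ) ^ ((max N k * (0 + 1)) ^ 2) ≤ (1 / 2) ^ k :=
    pow_le_pow_of_le_one (by norm_num) (by norm_num) h1
  unfold slotBound
  linarith

open Classical in
/-- The costs `a i` can be distributed among the slots of the `n`-th neighbourhood. -/
def Slotted (n : ℕ) (a : ι → ℝ) : Prop :=
  ∀ r, (Finset.univ.filter fun i => slotBound n r ≤ a i).card ≤ r

/-- The words whose pairs can be distributed among the slots of the `n`-th neighbourhood. -/
def gaugeWords (c : X → X → ℝ) (n : ℕ) : Set (FreeAbelianGroup X) :=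
  {g | ∃ (k : ℕ) (x y : Fin k → X), (∀ i : Fin k, c (x i) (y i) < slotBound n i) ∧
    g = pairSum x y}

theorem slotted_of_lt {n k : ℕ} {a : Fin k → ℝ} (h : ∀ i, a i < slotBound n i) : Slotted n a := by
  classical
  intro r
  refine (Finset.card_le_card_of_injOn (t := Finset.range r) (fun i : Fin k => (i : ℕ))
    (fun i hi => ?_) Fin.val_injective.injOn).trans (Finset.card_range r).le
  have hi := (Finset.mem_filter.1 (Finset.mem_coe.1 hi)).2
  by_contra hr
  have := slotBound_anti (n := n) (show r ≤ i by simpa using hr)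
  linarith [h i]

theorem Slotted.of_injective {n : ℕ} {a : ι → ℝ} {b : κ → ℝ} (hb : Slotted n b) (e : ι → κ)
    (he : Function.Injective e) (hab : ∀ i, a i ≤ b (e i)) : Slotted n a := by
  classical
  intro r
  refine (Finset.card_le_card_of_injOn e (fun i hi => ?_) he.injOn).trans (hb r)
  have hi := (Finset.mem_filter.1 (Finset.mem_coe.1 hi)).2
  simpa using hi.trans (hab i)

/-- Sort the costs in decreasing order: if the entry at index `i` overflowed its slot, then `i + 1`
costs would be at least `slotBound n i`, one more than allowed. -/
theorem Slotted.exists_sort {n : ℕ} {k : ℕ} {a : Fin k → ℝ} (h : Slotted n a) :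
    ∃ σ : Equiv.Perm (Fin k), ∀ i, a (σ i) < slotBound n i := by
  classical
  refine ⟨Tuple.sort (fun i => -a i), fun i => ?_⟩
  have hmono := Tuple.monotone_sort (fun i => -a i)
  set σ := Tuple.sort (fun i => -a i)
  have hσ : Slotted n (a ∘ σ) := h.of_injective σ σ.injective fun i => le_rfl
  by_contra! hi
  have hsub : Finset.Iic i ⊆ Finset.univ.filter fun j => slotBound n i ≤ (a ∘ σ) j := by
    intro j hj
    have := hmono (Finset.mem_Iic.1 hj)
    simp only [Function.comp] at this
    simp only [Finset.mem_filter, Finset.mem_univ, true_and, Function.comp]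
    linarith
  have := (Finset.card_le_card hsub).trans (hσ i)
  simp at this

theorem pairSum_mem_gaugeWords {c : X → X → ℝ} {n : ℕ} {x y : ι → X}
    (h : Slotted n fun i => c (x i) (y i)) : pairSum x y ∈ gaugeWords c n := by
  let e := (Fintype.equivFin ι).symm
  have h' : Slotted n fun i => c (x (e i)) (y (e i)) :=
    h.of_injective e e.injective fun i => le_rfl
  obtain ⟨σ, hσ⟩ := h'.exists_sort
  refine ⟨_, x ∘ (σ.trans e), y ∘ (σ.trans e), hσ, ?_⟩
  rw [pairSum_comp_equiv]

/-- The bound at `r / 2` for `2 * n` does not exceed the bound at `r` for `n`, so each family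
contributes at most `r / 2` expensive pairs. -/
theorem Slotted.sumElim {n : ℕ} {a : ι → ℝ} {b : κ → ℝ} (ha : Slotted (2 * n) a)
    (hb : Slotted (2 * n) b) : Slotted n (Sum.elim a b) := by
  classical
  intro r
  have hle : slotBound (2 * n) (r / 2) ≤ slotBound n r := by
    refine slotBound_le ?_
    have : r + 1 ≤ 2 * (r / 2 + 1) := by omega
    nlinarith
  have h1 : (Finset.univ.filter fun i => slotBound n r ≤ a i).card ≤ r / 2 := by
    refine (Finset.card_le_card fun i hi => ?_).trans (ha (r / 2))
    simp only [Finset.mem_filter, Finset.mem_univ, true_and] at hi ⊢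
    exact hle.trans hi
  have h2 : (Finset.univ.filter fun i => slotBound n r ≤ b i).card ≤ r / 2 := by
    refine (Finset.card_le_card fun i hi => ?_).trans (hb (r / 2))
    simp only [Finset.mem_filter, Finset.mem_univ, true_and] at hi ⊢
    exact hle.trans hi
  have h3 : (Finset.univ.filter fun i => slotBound n r ≤ Sum.elim a b i) =
      (Finset.univ.filter fun i => slotBound n r ≤ a i).disjSum
        (Finset.univ.filter fun i => slotBound n r ≤ b i) := by
    ext (i | i) <;> simp
  have h4 : (Finset.univ.filter fun i => slotBound n r ≤ Sum.elim a b i).card ≤ r := by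
    rw [h3, Finset.card_disjSum]
    omega
  convert h4

theorem hasTail_of_lt {n k : ℕ} (hn : 1 ≤ n) {a : Fin k → ℝ} (h : ∀ i, a i < slotBound n i)
    (r : ℕ) : HasTail a r (2 * slotBound n r) := by
  classical
  refine hasTail_iff.2 ⟨Finset.univ.filter fun i => (i : ℕ) < r, ?_, ?_⟩
  · exact (Finset.card_le_card_of_injOn (t := Finset.range r) (fun i : Fin k => (i : ℕ))
      (fun i hi => by simpa using hi) Fin.val_injective.injOn).trans (Finset.card_range r).le
  have hgeom : ∀ d, ∑ i ∈ Finset.Ico r (r + d), slotBound n i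
      ≤ 2 * slotBound n r - 2 * slotBound n (r + d) := by
    intro d
    induction d with
    | zero => simp
    | succ d ih =>
      rw [← add_assoc, Finset.sum_Ico_succ_top (by omega)]
      have := slotBound_succ hn (r + d)
      linarith
  calc _ ≤ ∑ i ∈ (Finset.univ.filter fun i : Fin k => (i : ℕ) < r)ᶜ, slotBound n i :=
        Finset.sum_le_sum fun i _ => (h i).le
    _ = ∑ i ∈ ((Finset.univ.filter fun i : Fin k => (i : ℕ) < r)ᶜ).map Fin.valEmbedding,
          slotBound n i := by rw [Finset.sum_map]; rfl
    _ ≤ ∑ i ∈ Finset.Ico r (r + k), slotBound n i := by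
        refine Finset.sum_le_sum_of_subset_of_nonneg ?_ fun i _ _ => (slotBound_pos n i).le
        intro i hi
        simp only [Finset.mem_map, Finset.mem_compl, Finset.mem_filter, Finset.mem_univ,
          true_and, not_lt] at hi
        obtain ⟨j, hj, rfl⟩ := hi
        have := j.2
        simp only [Fin.valEmbedding_apply, Finset.mem_Ico]
        omega
    _ ≤ _ := hgeom k
    _ ≤ _ := by linarith [slotBound_pos n (r + k)]

section Group

variable {c : X → X → ℝ}

theorem zero_mem_gaugeWords (c : X → X → ℝ) (n : ℕ) : 0 ∈ gaugeWords c n :=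
  ⟨0, Fin.elim0, Fin.elim0, fun i => i.elim0, by simp [pairSum]⟩

theorem gaugeWords_anti {n m : ℕ} (h : n ≤ m) : gaugeWords c m ⊆ gaugeWords c n := by
  rintro _ ⟨k, x, y, hxy, rfl⟩
  exact ⟨k, x, y, fun i => (hxy i).trans_le (slotBound_le (Nat.mul_le_mul_right _ h)), rfl⟩

theorem add_mem_gaugeWords {n : ℕ} {g h : FreeAbelianGroup X} (hg : g ∈ gaugeWords c (2 * n))
    (hh : h ∈ gaugeWords c (2 * n)) : g + h ∈ gaugeWords c n := by
  obtain ⟨k, x, y, hxy, rfl⟩ := hg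
  obtain ⟨l, a, b, hab, rfl⟩ := hh
  rw [← pairSum_sumElim]
  refine pairSum_mem_gaugeWords ?_
  convert! (slotted_of_lt hxy).sumElim (slotted_of_lt hab) using 1
  ext (i | i) <;> rfl

theorem neg_mem_gaugeWords (hc : ∀ x y, c x y = c y x) {n : ℕ} {g : FreeAbelianGroup X}
    (hg : g ∈ gaugeWords c n) : -g ∈ gaugeWords c n := by
  obtain ⟨k, x, y, hxy, rfl⟩ := hg
  exact ⟨k, y, x, fun i => by rw [hc]; exact hxy i, (pairSum_swap x y).symm⟩

end Group

end Slots

/-! ### The candidates for clopen neighborhoods. -/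

section StableWords

variable {X ι : Type*} [Fintype ι] {c : X → X → ℝ}

/-- The elements that have a stable matching whose pairs can be distributed among the slots of the
`n`-th neighbourhood. -/
def stableWords (c : X → X → ℝ) (n : ℕ) : Set (FreeAbelianGroup X) :=
  {g | ∃ (k : ℕ) (x y : Fin k → X), IsStable c x y ∧ Slotted n (fun i => c (x i) (y i)) ∧
    g = pairSum x y}

theorem pairSum_mem_stableWords {n : ℕ} {x y : ι → X} (hst : IsStable c x y)
    (hs : Slotted n fun i => c (x i) (y i)) : pairSum x y ∈ stableWords c n := by
  let e := (Fintype.equivFin ι).symm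
  exact ⟨_, x ∘ e, y ∘ e, fun i j => hst (e i) (e j),
    hs.of_injective e e.injective fun i => le_rfl, (pairSum_comp_equiv e x y).symm⟩

theorem stableWords_subset_gaugeWords (n : ℕ) : stableWords c n ⊆ gaugeWords c n := by
  rintro _ ⟨k, x, y, -, hs, rfl⟩
  exact pairSum_mem_gaugeWords hs

theorem exists_stable_eq_pairSum {k : ℕ} (a b : Fin k → X) :
    ∃ x y : Fin k → X, IsStable c x y ∧ pairSum x y = pairSum a b := by
  obtain ⟨σ, hσ⟩ := exists_stable_permutation c a b
  refine ⟨a, b ∘ σ, hσ, ?_⟩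
  rw [pairSum_comp_right σ a b]

theorem zero_mem_stableWords (c : X → X → ℝ) (n : ℕ) : 0 ∈ stableWords c n :=
  ⟨0, Fin.elim0, Fin.elim0, fun i => i.elim0, fun r => by simp, by simp [pairSum]⟩

end StableWords

/-! ### Stability of matchings under small perturbations. -/

section Perturbation

variable {X π ι κ : Type*} [MetricSpace X] [Fintype π] [Fintype ι] [Fintype κ] {c : X → X → ℝ}

namespace IsGauge

/-- A small perturbation does not move the positive letters of a reduced word. -/
theorem exists_letter_injection [DecidableEq ι] (hc : IsGauge c) {u v : π → X}
    {x y : ι → X} {a b : κ → X} (heq : pairSum x y = pairSum u v + pairSum a b) (J : Finset ι)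
    {η : ℝ} (hη : 0 < η) (hsep : ∀ i j, η ≤ dist (u i) (v j))
    (hlt : ∑ i ∈ Jᶜ, c (x i) (y i) + ∑ j, c (a j) (b j) < η) :
    ∃ α : π → ι, Function.Injective α ∧ (∀ i, α i ∈ J) ∧ ∀ i, dist (x (α i)) (u i) < η := by
  let t : π → Finset ι := fun i => J.filter fun j => dist (x j) (u i) < η
  -- Hall's marriage theorem: a bump of height `η` on `u '' A` shows that `A.card * η` is less than
  -- `η` times one more than the number of indices in `J` with `x j` near `u '' A`.
  obtain ⟨α, hα, hαt⟩ := (Finset.all_card_le_biUnion_card_iff_exists_injective t).1 (by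
    intro A
    obtain ⟨f, hfl, hf0, hfs, hfA, hfz⟩ := exists_bump (u '' A) hη.le
    have h := congrArg (FreeAbelianGroup.lift f) heq
    rw [map_add, lift_pairSum, lift_pairSum, lift_pairSum, ← Finset.sum_add_sum_compl J] at h
    have h1 : A.card * η ≤ ∑ i, (f (u i) - f (v i)) := by
      have hv : ∀ i, f (v i) = 0 := fun i => hfz _ (by
        rintro _ ⟨j, _, rfl⟩
        rw [dist_comm]
        exact hsep j i)
      simp only [hv, sub_zero]
      calc A.card * η = ∑ i ∈ A, f (u i) := by
            rw [Finset.sum_congr rfl fun i hi => hfA _ ⟨i, hi, rfl⟩]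
            simp
        _ ≤ _ := Finset.sum_le_sum_of_subset_of_nonneg (Finset.subset_univ _)
            fun i _ _ => hf0 _
    have h2 : ∑ j ∈ J, (f (x j) - f (y j)) ≤ (A.biUnion t).card * η := by
      calc ∑ j ∈ J, (f (x j) - f (y j)) ≤ ∑ j ∈ J, f (x j) :=
            Finset.sum_le_sum fun j _ => by linarith [hf0 (y j)]
        _ = ∑ j ∈ A.biUnion t, f (x j) := by
            symm
            refine Finset.sum_subset (Finset.biUnion_subset.2 fun i _ => Finset.filter_subset _ _)
              fun j hj hjt => hfz _ ?_
            rintro _ ⟨i, hi, rfl⟩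
            by_contra! hlt
            exact hjt (Finset.mem_biUnion.2 ⟨i, hi, Finset.mem_filter.2 ⟨hj, hlt⟩⟩)
        _ ≤ ∑ _j ∈ A.biUnion t, η := Finset.sum_le_sum fun j _ => hfs _
        _ = _ := by simp
    have h3 : ∑ j ∈ Jᶜ, (f (x j) - f (y j)) ≤ ∑ j ∈ Jᶜ, c (x j) (y j) :=
      Finset.sum_le_sum fun j _ => (hfl _ _).trans (hc.dist_le _ _)
    have h4 : -∑ j, c (a j) (b j) ≤ ∑ j, (f (a j) - f (b j)) := by
      rw [← Finset.sum_neg_distrib]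
      refine Finset.sum_le_sum fun j _ => ?_
      have := hfl (b j) (a j)
      have := hc.dist_le (a j) (b j)
      rw [dist_comm] at this
      linarith
    have h5 : (A.card : ℝ) * η < ((A.biUnion t).card + 1) * η := by linarith
    have h6 := lt_of_mul_lt_mul_right h5 hη.le
    exact Nat.lt_succ_iff.1 (by exact_mod_cast h6))
  exact ⟨α, hα, fun i => (Finset.mem_filter.1 (hαt i)).1, fun i => (Finset.mem_filter.1 (hαt i)).2⟩

theorem exists_radius (hc : IsGauge c) {u v : π → X} (huv : ∀ i j, u i ≠ v j) :
    ∃ η : ℝ, 0 < η ∧ (∀ i j, η ≤ dist (u i) (v j)) ∧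
      ∀ i j x y, dist x (u i) < η → dist y (v j) < η → c x y = c (u i) (v j) := by
  have h : ∀ᶠ η : ℝ in 𝓝[>] 0, ∀ i j, (η ≤ dist (u i) (v j)) ∧
      ∀ x y, dist x (u i) < η → dist y (v j) < η → c x y = c (u i) (v j) := by
    refine eventually_all.2 fun i => eventually_all.2 fun j => ?_
    obtain ⟨ε, hε, hball⟩ := Metric.eventually_nhds_iff.1 (hc.locallyConst _ _ (huv i j))
    filter_upwards [Ioo_mem_nhdsGT (lt_min hε (dist_pos.2 (huv i j)))] with η hη
    obtain ⟨-, hη⟩ := hη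
    rw [lt_min_iff] at hη
    refine ⟨hη.2.le, fun x y hx hy => hball (y := (x, y)) ?_⟩
    rw [Prod.dist_eq, max_lt_iff]
    exact ⟨hx.trans hη.1, hy.trans hη.1⟩
  obtain ⟨η, hη, hpos⟩ := (h.and self_mem_nhdsWithin).exists
  exact ⟨η, hpos, fun i j => (hη i j).1, fun i j => (hη i j).2⟩

/-- If `h` differs from the reduced word `∑ (u i - v i)` by a sufficiently small word, then any
stable matching of `h` consists of pairs of letters close to the letters `u i` and `v i`, and of
pairs of very small cost. -/
theorem exists_perturbation_bound (hc : IsGauge c) {u v : π → X} (huv : ∀ i j, u i ≠ v j)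
    (n : ℕ) : ∃ m, ∀ w ∈ gaugeWords c m, ∀ (k : ℕ) (x y : Fin k → X), IsStable c x y →
      pairSum x y = pairSum u v + w →
      (∀ r, HasTail (fun i => c (x i) (y i)) (Fintype.card π + r) (6 * slotBound m r)) ∧
      (∀ r, 6 * slotBound m r < slotBound n (Fintype.card π + r)) ∧
      ∃ α β : π → Fin k, Function.Injective α ∧ Function.Injective β ∧
        (∀ i, i ∈ Set.range α ↔ i ∈ Set.range β) ∧
        (∀ i j, c (x (α i)) (y (β j)) = c (u i) (v j)) ∧
        (∀ i ∉ Set.range α, c (x i) (y i) < slotBound n (Fintype.card π)) ∧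
        ∀ i ∉ Set.range α, ∀ j ∈ Set.range α, c (x i) (y i) ≤ c (x j) (y j) := by
  classical
  obtain ⟨η, hη, hsep, hconst⟩ := hc.exists_radius huv
  -- The factor `8` is `6 + 2`: the tail of the stable matching plus the total cost of `w`. The
  -- lower bound on `m` leaves room for the `Fintype.card π` large pairs.
  obtain ⟨m, hm, hmη⟩ := exists_slotBound_lt hη (n * (Fintype.card π + 1) + 2)
  refine ⟨m, ?_⟩
  rintro _ ⟨l, a, b, hab, rfl⟩ k x y hst heq
  have hm2 : 2 ≤ m := by omega
  have htail : ∀ r, HasTail (fun i => c (x i) (y i)) (Fintype.card π + r)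
      (6 * slotBound m r) := by
    intro r
    have h := hc.hasTail_of_stable (a := Sum.elim u a) (b := Sum.elim v b)
      (θ := fun r => 2 * slotBound m r) (p := Fintype.card π) hst (by rw [pairSum_sumElim, heq])
      (fun r => by linarith [slotBound_pos m r])
      (fun r => by linarith [slotBound_succ_of_two_le hm2 r]) (fun r => by
        convert! (hasTail_of_lt (by omega) hab r).sumElim (a := fun i => c (u i) (v i)) using 1
        ext (i | i) <;> rfl) r
    convert! h using 1
    ring
  refine ⟨htail, slotBound_lt_of_le hm, ?_⟩
  obtain ⟨J, hJ, hJs⟩ := hasTail_iff.1 (htail 0)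
  obtain ⟨J0, hJ0, hJ0s⟩ := hasTail_iff.1 (hasTail_of_lt (by omega) hab 0)
  obtain rfl : J0 = ∅ := by simpa using hJ0
  have hsmall : ∑ i ∈ Jᶜ, c (x i) (y i) + ∑ j, c (a j) (b j) < η := by
    rw [Finset.compl_empty] at hJ0s
    linarith [hJ0s, hJs]
  obtain ⟨α, hα, hαJ, hαd⟩ := hc.exists_letter_injection heq J hη hsep hsmall
  obtain ⟨β, hβ, hβJ, hβd⟩ := hc.exists_letter_injection (u := v) (v := u) (x := y) (y := x)
    (a := b) (b := a)
    (by rw [pairSum_swap x y, pairSum_swap u v, pairSum_swap a b, heq, neg_add]) J hη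
    (fun i j => by rw [dist_comm]; exact hsep j i) (by
      simp only [hc.symm (y _), hc.symm (b _)]
      convert! hsmall)
  -- Since `J` has at most `Fintype.card π` elements, an injection of `π` into `J` is onto; hence
  -- `α` and `β` have the same range.
  have hrange : ∀ γ : π → Fin k, Function.Injective γ → (∀ i, γ i ∈ J) →
      ∀ i, i ∈ Set.range γ ↔ i ∈ J := by
    intro γ hγ hγJ i
    have : Finset.univ.image γ = J := by
      refine Finset.eq_of_subset_of_card_le (fun j hj => ?_) ?_
      · obtain ⟨i, -, rfl⟩ := Finset.mem_image.1 hj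
        exact hγJ i
      · rw [Finset.card_image_of_injective _ hγ]
        simpa using hJ
    rw [← this]
    simp
  have hcost : ∀ i j, c (x (α i)) (y (β j)) = c (u i) (v j) := fun i j =>
    hconst i j _ _ (hαd i) (hβd j)
  have hJc : ∀ i ∉ J, c (x i) (y i) ≤ 6 * slotBound m 0 := fun i hi =>
    (Finset.single_le_sum (f := fun i => c (x i) (y i)) (fun j _ => hc.nonneg _ _)
      (Finset.mem_compl.2 hi)).trans hJs
  refine ⟨α, β, hα, hβ, fun i => by rw [hrange α hα hαJ, hrange β hβ hβJ], hcost, ?_, ?_⟩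
  · intro i hi
    rw [hrange α hα hαJ] at hi
    exact (hJc i hi).trans_lt (slotBound_lt_of_le hm 0)
  · intro i hi j hj
    rw [hrange α hα hαJ] at hi
    have hj' := hj
    rw [hrange α hα hαJ, ← hrange β hβ hβJ] at hj'
    obtain ⟨i', rfl⟩ := hj
    obtain ⟨j', hj'⟩ := hj'
    have h1 := hcost i' j'
    rw [hj'] at h1
    rw [h1]
    refine (hJc i hi).trans (le_trans ?_ ((hsep i' j').trans (hc.dist_le _ _)))
    linarith [slotBound_pos m 0]

end IsGauge

namespace IsGauge

/-- Omitting the trivial pairs of a stable matching, we obtain a stable matching of a reduced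
word. -/
theorem exists_reduced (hc : IsGauge c) {x y : ι → X} (hst : IsStable c x y) :
    ∃ (k : ℕ) (u v : Fin k → X) (e : Fin k → ι), Function.Injective e ∧ IsStable c u v ∧
      (∀ i j, u i ≠ v j) ∧ (∀ i, u i = x (e i) ∧ v i = y (e i)) ∧
      pairSum u v = pairSum x y := by
  classical
  let e := (Fintype.equivFin {i // x i ≠ y i}).symm
  refine ⟨_, fun i => x (e i), fun i => y (e i), fun i => e i,
    Subtype.val_injective.comp e.injective, fun i j => hst (e i) (e j), fun i j h => ?_,
    fun i => ⟨rfl, rfl⟩, ?_⟩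
  · have := hst (e i) (e j)
    beta_reduce at h
    rw [h, hc.self] at this
    rcases min_le_iff.1 this with h1 | h1
    · exact absurd h1 (not_le.2 (hc.pos (h ▸ (e i).2)))
    · exact absurd h1 (not_le.2 (hc.pos (e j).2))
  · refine (pairSum_comp_equiv e (fun i : {i // x i ≠ y i} => x i) fun i => y i).trans ?_
    rw [pairSum, pairSum]
    rw [← Finset.sum_subtype (Finset.univ.filter fun i => x i ≠ y i) (by simp)
      fun i => FreeAbelianGroup.of (x i) - FreeAbelianGroup.of (y i)]
    exact Finset.sum_filter_of_ne fun i _ h hxy => h (by rw [hxy, sub_self])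

/-- This makes the complement open. The large pairs of the stable matching of the perturbed word,
read back through `α` and `β`, match the `u i` with the `v j` at the same costs. -/
theorem pairSum_mem_stableWords_of_add_mem (hc : IsGauge c) (n : ℕ) {k : ℕ} (a b : Fin k → X) :
    ∃ m, ∀ w ∈ gaugeWords c m, pairSum a b + w ∈ stableWords c n →
      pairSum a b ∈ stableWords c n := by
  classical
  obtain ⟨x0, y0, hst0, heq0⟩ := exists_stable_eq_pairSum (c := c) a b
  obtain ⟨p, u, v, -, -, -, huv, -, heq⟩ := hc.exists_reduced hst0
  obtain ⟨m, hm⟩ := hc.exists_perturbation_bound huv n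
  refine ⟨m, fun w hw hmem => ?_⟩
  obtain ⟨l, x, y, hst, hs, hxy⟩ := hmem
  obtain ⟨-, -, α, β, hα, hβ, hαβ, hcost, -, -⟩ :=
    hm w hw l x y hst (by rw [← hxy, heq, heq0])
  have hex : ∀ i, ∃ j, β j = α i := fun i => (hαβ _).1 ⟨i, rfl⟩
  choose σ hσ using hex
  have hσinj : Function.Injective σ := fun i j h => hα (by rw [← hσ, ← hσ, h])
  let e := Equiv.ofBijective σ (Finite.injective_iff_bijective.1 hσinj)
  have hc' : ∀ i j, c (u i) (v (σ j)) = c (x (α i)) (y (α j)) := fun i j => by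
    rw [← hcost, hσ]
  have : pairSum a b = pairSum u (v ∘ e) := by
    rw [pairSum_comp_right e u v, heq, heq0]
  rw [this]
  refine pairSum_mem_stableWords (fun i j => ?_) (hs.of_injective α hα fun i => (hc' i i).le)
  change min (c (u i) (v (σ i))) (c (u j) (v (σ j))) ≤ c (u i) (v (σ j))
  rw [hc', hc', hc']
  exact hst _ _

/-- This gives openness. Any stable matching of the perturbed word can be re-paired on its large
pairs to copy the given matching of `u` and `v`. -/
theorem exists_add_mem_stableWords (hc : IsGauge c) (n : ℕ) {g : FreeAbelianGroup X}
    (hg : g ∈ stableWords c n) : ∃ m, ∀ w ∈ gaugeWords c m, g + w ∈ stableWords c n := by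
  classical
  obtain ⟨k0, x0, y0, hst0, hs0, rfl⟩ := hg
  obtain ⟨p, u, v, e0, he0, hstu, huv, hue, heq⟩ := hc.exists_reduced hst0
  have hsu : Slotted n fun i => c (u i) (v i) :=
    hs0.of_injective e0 he0 fun i => by rw [(hue i).1, (hue i).2]
  obtain ⟨m, hm⟩ := hc.exists_perturbation_bound huv n
  refine ⟨m, fun w hw => ?_⟩
  obtain ⟨l, x, y, hst, hxy⟩ : ∃ (l : ℕ) (x y : Fin l → X), IsStable c x y ∧
      pairSum x y = pairSum u v + w := by
    obtain ⟨l, a, b, -, rfl⟩ := id hw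
    obtain ⟨x, y, hst, hxy⟩ := exists_stable_eq_pairSum (c := c) (Fin.append u a) (Fin.append v b)
    refine ⟨_, x, y, hst, ?_⟩
    rw [hxy]
    simp only [pairSum, Fin.sum_univ_add, Fin.append_left, Fin.append_right]
  obtain ⟨-, -, α, β, hα, hβ, hαβ, hcost, hsmall, hbig⟩ := hm w hw l x y hst hxy
  -- Re-pair `x (α i)` with `y (β i)` and leave the small pairs alone. Stability survives between
  -- large and small pairs because every small pair costs no more than any large one.
  let τ' : Equiv.Perm (Set.range α) :=
    (Equiv.ofInjective α hα).symm.trans ((Equiv.ofInjective β hβ).trans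
      (Equiv.setCongr (Set.ext fun i => (hαβ i).symm)))
  let τ : Equiv.Perm (Fin l) := Equiv.Perm.ofSubtype τ'
  have hτα : ∀ i, τ (α i) = β i := by
    intro i
    refine (Equiv.Perm.ofSubtype_apply_of_mem τ' ⟨i, rfl⟩).trans ?_
    simp [τ']
  have hτ : ∀ i ∉ Set.range α, τ i = i := fun i hi => Equiv.Perm.ofSubtype_apply_of_not_mem τ' hi
  have hstτ : IsStable c x (y ∘ τ) := by
    intro i j
    simp only [Function.comp]
    by_cases hi : i ∈ Set.range α
    · obtain ⟨i, rfl⟩ := hi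
      by_cases hj : j ∈ Set.range α
      · obtain ⟨j, rfl⟩ := hj
        simp only [hτα, hcost]
        exact hstu i j
      · rw [hτ j hj]
        refine (min_le_right _ _).trans (le_trans (le_min ?_ le_rfl) (hst (α i) j))
        exact hbig j hj _ ⟨i, rfl⟩
    · rw [hτ i hi]
      by_cases hj : j ∈ Set.range α
      · refine (min_le_left _ _).trans (le_trans (le_min le_rfl ?_) (hst i (τ j)))
        refine hbig i hi _ ?_
        obtain ⟨j, rfl⟩ := hj
        rw [hτα, hαβ]
        exact ⟨j, rfl⟩
      · rw [hτ j hj]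
        exact hst i j
  have heqτ : pairSum x (y ∘ τ) = pairSum u v + w := by
    rw [pairSum_comp_right τ x y, hxy]
  -- The tail estimate, applied now to the re-paired matching, handles `r ≥ p`; for `r < p` only the
  -- copied pairs can reach the bound.
  obtain ⟨htail, hlt, -⟩ := hm w hw l x _ hstτ heqτ
  rw [← heq, ← heqτ]
  refine pairSum_mem_stableWords hstτ fun r => ?_
  rcases le_or_gt p r with hr | hr
  · obtain ⟨d, rfl⟩ := Nat.exists_eq_add_of_le hr
    have h1 := htail d
    have h2 := hlt d
    simp only [Fintype.card_fin] at h1 h2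
    exact h1.card_lt_le (fun i => hc.nonneg _ _) h2
  · have hsub : (Finset.univ.filter fun i => slotBound n r ≤ c (x i) ((y ∘ τ) i)) ⊆
        (Finset.univ.filter fun i => slotBound n r ≤ c (u i) (v i)).image α := by
      intro i hi
      have hi := (Finset.mem_filter.1 hi).2
      by_cases hiα : i ∈ Set.range α
      · obtain ⟨i, rfl⟩ := hiα
        refine Finset.mem_image_of_mem _ (Finset.mem_filter.2 ⟨Finset.mem_univ _, ?_⟩)
        simpa only [Function.comp, hτα, hcost] using hi
      · have h1 := hsmall i hiα
        simp only [Function.comp, hτ i hiα] at hi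
        have h2 := slotBound_anti (n := n) hr.le
        simp only [Fintype.card_fin] at h1
        linarith
    refine (Finset.card_le_card hsub).trans (Finset.card_image_le.trans ?_)
    convert! hsu r

end IsGauge

end Perturbation

/-! ### Recognizing generators, and the group topology. -/

section FreeAbelianGroup

variable {X : Type*}

/-- An element with nonnegative coefficients that add up to one is a generator. -/
theorem FreeAbelianGroup.mem_range_of {g : FreeAbelianGroup X}
    (h0 : ∀ v, 0 ≤ FreeAbelianGroup.coeff v g)
    (h1 : FreeAbelianGroup.lift (fun _ : X => (1 : ℤ)) g = 1) :
    g ∈ Set.range (FreeAbelianGroup.of : X → FreeAbelianGroup X) := by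
  have hg := FreeAbelianGroup.eq_sum_support_coeff_smul_of g
  have hsum : ∑ x ∈ g.support, FreeAbelianGroup.coeff x g = 1 := by
    rw [← h1]
    conv_rhs => rw [hg]
    simp [map_sum]
  have hpos : ∀ x ∈ g.support, 1 ≤ FreeAbelianGroup.coeff x g := fun x hx => by
    have := (FreeAbelianGroup.mem_support_iff x g).1 hx
    have := h0 x
    omega
  have hcard : g.support.card = 1 := by
    have h2 : (g.support.card : ℤ) ≤ 1 := by
      rw [← hsum]
      simpa using Finset.card_nsmul_le_sum g.support _ 1 hpos
    have h3 : g.support.card ≠ 0 := fun h => by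
      rw [Finset.card_eq_zero.1 h] at hsum
      simp at hsum
    omega
  obtain ⟨x, hx⟩ := Finset.card_eq_one.1 hcard
  rw [hx, Finset.sum_singleton] at hsum
  rw [hx, Finset.sum_singleton, hsum, one_smul] at hg
  exact ⟨x, hg.symm⟩

end FreeAbelianGroup

section GroupTopology

variable {X : Type*} [MetricSpace X] {c : X → X → ℝ}

namespace IsGauge

/-- Homomorphisms extending 1-Lipschitz functions are small on small words; this yields separation,
the embedding and closedness of `X`. -/
theorem lift_le_of_mem_gaugeWords (hc : IsGauge c) {m : ℕ} (hm : 1 ≤ m) {w : FreeAbelianGroup X}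
    (hw : w ∈ gaugeWords c m) {f : X → ℝ} (hf : ∀ x y, f x - f y ≤ dist x y) :
    FreeAbelianGroup.lift f w ≤ 2 * slotBound m 0 := by
  obtain ⟨k, a, b, hab, rfl⟩ := hw
  obtain ⟨J, hJ, hJs⟩ := hasTail_iff.1 (hasTail_of_lt hm hab 0)
  obtain rfl : J = ∅ := by simpa using hJ
  rw [Finset.compl_empty] at hJs
  rw [lift_pairSum]
  exact (Finset.sum_le_sum fun i _ => (hf _ _).trans (hc.dist_le _ _)).trans hJs

theorem exists_slotBound_two_mul_lt {η : ℝ} (hη : 0 < η) :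
    ∃ m, 1 ≤ m ∧ 2 * slotBound m 0 < η := by
  obtain ⟨m, hm, h⟩ := exists_slotBound_lt hη 1
  exact ⟨m, hm, by linarith [slotBound_pos m 0]⟩

end IsGauge

/-- A bump function around a point detects the coefficient of that point in an element of the free
abelian group. -/
theorem exists_lift_eq_coeff (g : FreeAbelianGroup X) (v : X) :
    ∃ f : X → ℝ, (∀ x y, f x - f y ≤ dist x y) ∧ (∀ x, 0 ≤ f x) ∧ ∃ η > 0,
      FreeAbelianGroup.lift f g = FreeAbelianGroup.coeff v g * η := by
  classical
  have h : ∀ᶠ η : ℝ in 𝓝[>] 0, ∀ x ∈ g.support.erase v, η ≤ dist x v := by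
    rw [Finset.eventually_all]
    intro x hx
    filter_upwards [Ioo_mem_nhdsGT (dist_pos.2 (Finset.ne_of_mem_erase hx))] with η hη
    exact hη.2.le
  obtain ⟨η, hη, hpos⟩ := (h.and self_mem_nhdsWithin).exists
  have hpos : 0 < η := hpos
  obtain ⟨f, hfl, hf0, -, hfA, hfz⟩ := exists_bump {v} hpos.le
  refine ⟨f, hfl, hf0, η, hpos, ?_⟩
  conv_lhs => rw [FreeAbelianGroup.eq_sum_support_coeff_smul_of g]
  rw [map_sum, ← hfA v rfl]
  simp only [map_zsmul, FreeAbelianGroup.lift_apply_of, zsmul_eq_mul]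
  refine Finset.sum_eq_single v (fun x hx hxv => ?_) fun hv => ?_
  · rw [hfz x, mul_zero]
    rintro _ rfl
    exact hη x (Finset.mem_erase.2 ⟨hxv, hx⟩)
  · rw [(FreeAbelianGroup.notMem_support_iff _ _).1 hv]
    simp

theorem smallInductiveDimension_eq_zero_of_clopen {Y : Type*} [TopologicalSpace Y] [Nonempty Y]
    (h : TopologicalSpace.IsTopologicalBasis {s : Set Y | IsClopen s}) :
    smallInductiveDimension Y = 0 :=
  smallInductiveDimension_eq 0 (hasSmallInductiveDimensionLT_one_iff.2 h) fun h0 =>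
    (hasSmallInductiveDimensionLT_zero_iff.1 h0).false (Classical.arbitrary Y)

theorem IsGauge.exists_groupTopology (hc : IsGauge c) :
    ∃ _ : TopologicalSpace (FreeAbelianGroup X),
      IsTopologicalAddGroup (FreeAbelianGroup X) ∧
      (𝓝 (0 : FreeAbelianGroup X)).HasBasis (fun _ : ℕ => True) (gaugeWords c) ∧
      TopologicalSpace.MetrizableSpace (FreeAbelianGroup X) ∧
      TopologicalSpace.IsTopologicalBasis {s : Set (FreeAbelianGroup X) | IsClopen s} ∧
      IsClosedEmbedding (FreeAbelianGroup.of : X → FreeAbelianGroup X) := by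
  let B : AddGroupFilterBasis (FreeAbelianGroup X) :=
    addGroupFilterBasisOfComm (Set.range (gaugeWords c)) (Set.range_nonempty _)
      (by
        rintro _ _ ⟨n, rfl⟩ ⟨m, rfl⟩
        exact ⟨_, ⟨max n m, rfl⟩, Set.subset_inter (gaugeWords_anti (le_max_left _ _))
          (gaugeWords_anti (le_max_right _ _))⟩)
      (by
        rintro _ ⟨n, rfl⟩
        exact zero_mem_gaugeWords c n)
      (by
        rintro _ ⟨n, rfl⟩
        refine ⟨_, ⟨2 * n, rfl⟩, ?_⟩
        rintro _ ⟨g, hg, h, hh, rfl⟩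
        exact add_mem_gaugeWords hg hh)
      (by
        rintro _ ⟨n, rfl⟩
        exact ⟨_, ⟨n, rfl⟩, fun g hg => neg_mem_gaugeWords hc.symm hg⟩)
  let τ : TopologicalSpace (FreeAbelianGroup X) := B.topology
  have hgrp : IsTopologicalAddGroup (FreeAbelianGroup X) := B.isTopologicalAddGroup
  have h0 : (𝓝 (0 : FreeAbelianGroup X)).HasBasis (fun _ : ℕ => True) (gaugeWords c) := by
    refine B.nhds_zero_hasBasis.to_hasBasis ?_ fun n _ => ⟨_, ⟨n, rfl⟩, subset_rfl⟩
    rintro _ ⟨n, rfl⟩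
    exact ⟨n, trivial, subset_rfl⟩
  have hnhds : ∀ g : FreeAbelianGroup X,
      (𝓝 g).HasBasis (fun _ : ℕ => True) fun n => (fun w => g + w) '' gaugeWords c n := by
    intro g
    rw [← map_add_left_nhds_zero]
    exact h0.map _
  have hclopen : ∀ n, IsClopen (stableWords c n) := by
    intro n
    refine ⟨⟨isOpen_iff_mem_nhds.2 fun g hg => ?_⟩, isOpen_iff_mem_nhds.2 fun g hg => ?_⟩
    -- Differences of matched letters form a subgroup; an element outside it is excluded by any
    -- basic neighborhood.
    · by_cases hd : ∃ (k : ℕ) (a b : Fin k → X), pairSum a b = g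
      · obtain ⟨k, a, b, rfl⟩ := hd
        obtain ⟨m, hm⟩ := hc.pairSum_mem_stableWords_of_add_mem n a b
        refine (hnhds _).mem_iff.2 ⟨m, trivial, ?_⟩
        rintro _ ⟨w, hw, rfl⟩ hmem
        exact hg (hm w hw hmem)
      · refine (hnhds _).mem_iff.2 ⟨0, trivial, ?_⟩
        rintro _ ⟨_, ⟨l, a, b, -, rfl⟩, rfl⟩ ⟨k, x, y, -, -, h⟩
        refine hd ⟨_, Fin.append x b, Fin.append y a, ?_⟩
        have h : g + pairSum a b = pairSum x y := h
        have h2 : pairSum (Fin.append x b) (Fin.append y a) = pairSum x y + pairSum b a := by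
          simp only [pairSum, Fin.sum_univ_add, Fin.append_left, Fin.append_right]
        rw [h2, ← h, pairSum_swap a b]
        abel
    · obtain ⟨m, hm⟩ := hc.exists_add_mem_stableWords n hg
      refine (hnhds _).mem_iff.2 ⟨m, trivial, ?_⟩
      rintro _ ⟨w, hw, rfl⟩
      exact hm w hw
  have hbasis : TopologicalSpace.IsTopologicalBasis
      {s : Set (FreeAbelianGroup X) | IsClopen s} := by
    refine TopologicalSpace.isTopologicalBasis_of_isOpen_of_nhds (fun s hs => hs.isOpen) ?_
    intro g U hg hU
    obtain ⟨n, -, hn⟩ := (hnhds g).mem_iff.1 (hU.mem_nhds hg)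
    refine ⟨(fun h => -g + h) ⁻¹' stableWords c n, ?_, ?_, ?_⟩
    · exact (hclopen n).preimage (continuous_const_add _)
    · simpa using zero_mem_stableWords c n
    · intro h hh
      exact hn ⟨-g + h, stableWords_subset_gaugeWords n hh, by simp⟩
  have ht2 : T2Space (FreeAbelianGroup X) := by
    refine IsTopologicalAddGroup.t2Space_of_zero_sep fun g hg => ?_
    obtain ⟨v, hv⟩ := FreeAbelianGroup.nonempty_support_iff.2 hg
    rw [FreeAbelianGroup.mem_support_iff] at hv
    obtain ⟨f, hfl, hf0, η, hη, hfg⟩ := exists_lift_eq_coeff g v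
    obtain ⟨m, hm, hmη⟩ := IsGauge.exists_slotBound_two_mul_lt hη
    refine ⟨_, h0.mem_of_mem (i := m) trivial, fun hmem => ?_⟩
    have h1 := hc.lift_le_of_mem_gaugeWords hm hmem hfl
    have h2 := hc.lift_le_of_mem_gaugeWords hm (neg_mem_gaugeWords hc.symm hmem) hfl
    rw [map_neg] at h2
    rw [hfg] at h1 h2
    rcases lt_or_gt_of_ne hv with h | h
    · have : (FreeAbelianGroup.coeff v g : ℝ) ≤ -1 := by exact_mod_cast Int.le_sub_one_of_lt h
      nlinarith
    · have : (1 : ℝ) ≤ FreeAbelianGroup.coeff v g := by exact_mod_cast h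
      nlinarith
  have hmetr : TopologicalSpace.MetrizableSpace (FreeAbelianGroup X) := by
    let := IsTopologicalAddGroup.rightUniformSpace (FreeAbelianGroup X)
    have := isUniformAddGroup_of_addCommGroup (G := FreeAbelianGroup X)
    have : (𝓝 (0 : FreeAbelianGroup X)).IsCountablyGenerated :=
      (HasAntitoneBasis.mk h0 fun _ _ h => gaugeWords_anti h).isCountablyGenerated
    have := IsUniformAddGroup.uniformity_countably_generated (α := FreeAbelianGroup X)
    exact UniformSpace.metrizableSpace
  refine ⟨τ, hgrp, h0, hmetr, hbasis, ⟨⟨isInducing_iff_nhds.2 fun x => ?_,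
    FreeAbelianGroup.of_injective⟩, isClosed_of_closure_subset fun g hg => ?_⟩⟩
  · refine Metric.nhds_basis_ball.ext ((hnhds _).comap _) (fun ε hε => ?_) fun n _ => ?_
    · obtain ⟨m, hm, hmε⟩ := IsGauge.exists_slotBound_two_mul_lt hε
      refine ⟨m, trivial, ?_⟩
      rintro y ⟨w, hw, hy⟩
      -- The distance to `x` serves as test function: its lift sends `of y - of x` to `dist y x`.
      have h1 := hc.lift_le_of_mem_gaugeWords hm hw (f := fun z => dist z x) fun a b => by
        linarith [dist_triangle a b x]
      have h2 := congrArg (FreeAbelianGroup.lift fun z => dist z x) hy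
      simp only [map_add, FreeAbelianGroup.lift_apply_of, dist_self, zero_add] at h2
      rw [Metric.mem_ball, ← h2]
      linarith
    · refine ⟨slotBound n 0 / 2, half_pos (slotBound_pos n 0), fun y hy => ?_⟩
      refine ⟨FreeAbelianGroup.of y - FreeAbelianGroup.of x, ⟨1, fun _ => y, fun _ => x,
        fun i => ?_, by simp [pairSum]⟩, by simp⟩
      have h1 := hc.le_dist y x
      have h2 := Metric.mem_ball.1 hy
      obtain rfl : i = 0 := Subsingleton.elim _ _
      exact h1.trans_lt (by simp only [Fin.val_zero]; linarith)
  -- Nonnegativity of each coefficient (by bumps) and total degree one both pass to the closure.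
  · have hcl := (mem_closure_iff_nhds_basis (hnhds g)).1 hg
    refine FreeAbelianGroup.mem_range_of (fun v => ?_) ?_
    · obtain ⟨f, hfl, hf0, η, hη, hfg⟩ := exists_lift_eq_coeff g v
      obtain ⟨m, hm, hmη⟩ := IsGauge.exists_slotBound_two_mul_lt hη
      obtain ⟨_, ⟨z, rfl⟩, w, hw, hz⟩ := hcl m trivial
      have h1 := hc.lift_le_of_mem_gaugeWords hm hw hfl
      have h2 := congrArg (FreeAbelianGroup.lift f) hz
      simp only [map_add, FreeAbelianGroup.lift_apply_of, hfg] at h2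
      by_contra! hv
      have : (FreeAbelianGroup.coeff v g : ℝ) ≤ -1 := by exact_mod_cast Int.le_sub_one_of_lt hv
      nlinarith [hf0 z]
    · obtain ⟨_, ⟨z, rfl⟩, _, ⟨k, a, b, -, rfl⟩, hz⟩ := hcl 0 trivial
      have h2 := congrArg (FreeAbelianGroup.lift fun _ : X => (1 : ℤ)) hz
      simpa [pairSum, map_sum] using h2

end GroupTopology

/-! ### From clopen uniformities to gauges, and back from groups. -/

section Uniform

variable {X : Type*}

theorem IsClopenUniformBase.exists_subordinate [UniformSpace X] {W : ℕ → SetRel X X}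
    (hW : IsClopenUniformBase W) : ∃ V : ℕ → SetRel X X, IsSubordinate W V := by
  have hstep : ∀ (i : ℕ) (s : SetRel X X), ∃ k, s ∈ 𝓤 X →
      W k ○ W k ○ W k ⊆ s ∧ W k ⊆ W i := by
    intro i s
    by_cases hs : s ∈ 𝓤 X
    · obtain ⟨t, ht, hts⟩ := comp3_mem_uniformity hs
      obtain ⟨k, -, hk⟩ := hW.hasBasis.mem_iff.1
        (inter_mem ht (hW.hasBasis.mem_of_mem (i := i) trivial))
      refine ⟨k, fun _ => ⟨?_, hk.trans Set.inter_subset_right⟩⟩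
      have hkt : W k ⊆ t := hk.trans Set.inter_subset_left
      rw [SetRel.comp_assoc]
      exact (SetRel.comp_subset_comp hkt (SetRel.comp_subset_comp hkt hkt)).trans hts
    · exact ⟨0, fun h => absurd h hs⟩
  choose f hf using hstep
  let V : ℕ → SetRel X X := fun n => Nat.rec Set.univ (fun i s => W (f i s)) n
  have hmem : ∀ i, V i ∈ 𝓤 X := by
    rintro (_ | i)
    · exact univ_mem
    · exact hW.hasBasis.mem_of_mem trivial
  refine ⟨V, rfl, hmem, ?_, ?_, fun i => (hf i (V i) (hmem i)).1,
    fun i => (hf i (V i) (hmem i)).2⟩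
  · rintro (_ | i)
    · exact ⟨fun _ _ _ => trivial⟩
    · exact hW.symm _
  · rintro (_ | i)
    · exact isClopen_univ
    · exact hW.clopen _

open scoped NNReal in
theorem IsSubordinate.exists_gauge [u : UniformSpace X] {W V : ℕ → SetRel X X}
    (hW : IsClopenUniformBase W) (hV : IsSubordinate W V) :
    ∃ (M : MetricSpace X) (c : X → X → ℝ), M.toUniformSpace = u ∧ IsGauge c ∧
      ∀ x y n, c x y < (1 / 2) ^ n ↔ (x, y) ∈ V n := by
  classical
  have hrefl : ∀ n x, (x, x) ∈ V n := fun n x => refl_mem_uniformity (hV.mem n)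
  have hanti : Antitone V := antitone_nat_of_succ_le fun n p hp =>
    hV.comp n ⟨p.2, ⟨p.2, hp, hrefl _ _⟩, hrefl _ _⟩
  have hsep : ∀ x y, (∀ n, (x, y) ∈ V n) → x = y := fun x y h =>
    hW.separated x y fun n => hV.subset n (h (n + 1))
  have hbasis : (𝓤 X).HasBasis (fun _ : ℕ => True) V := by
    refine hW.hasBasis.to_hasBasis (fun n _ => ⟨n + 1, trivial, hV.subset n⟩) fun n _ => ?_
    exact (hW.hasBasis.mem_iff.1 (hV.mem n))
  set d : X → X → ℝ≥0 := fun x y => if h : ∃ n, (x, y) ∉ V n then (1 / 2) ^ Nat.find h else 0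
    with hd
  have hd_self : ∀ x, d x x = 0 := fun x => dif_neg (by simp [hrefl])
  have hd_symm : ∀ x y, d x y = d y x := by
    intro x y
    have : ∀ n, (x, y) ∈ V n ↔ (y, x) ∈ V n := fun n =>
      ⟨fun h => (hV.symm n).symm _ _ h, fun h => (hV.symm n).symm _ _ h⟩
    simp only [hd, this]
  have hr : (1 / 2 : ℝ≥0) ∈ Set.Ioo (0 : ℝ≥0) 1 :=
    ⟨half_pos one_pos, NNReal.half_lt_self one_ne_zero⟩
  have hle_d : ∀ {x y : X} {n : ℕ}, (1 / 2) ^ n ≤ d x y ↔ (x, y) ∉ V n := by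
    intro x y n
    dsimp only [d]
    split_ifs with h
    · rw [(pow_right_strictAnti₀ hr.1 hr.2).le_iff_ge, Nat.find_le_iff]
      exact ⟨fun ⟨m, hmn, hm⟩ hn => hm (hanti hmn hn), fun h => ⟨n, le_rfl, h⟩⟩
    · push Not at h
      simp only [h, not_true, (pow_pos hr.1 _).not_ge]
  let I := PseudoMetricSpace.ofPreNNDist d hd_self hd_symm
  have hdist_le : ∀ x y, I.dist x y ≤ d x y := PseudoMetricSpace.dist_ofPreNNDist_le _ _ _
  have hd_le : ∀ x y, (d x y : ℝ) ≤ 2 * I.dist x y := by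
    refine PseudoMetricSpace.le_two_mul_dist_ofPreNNDist _ _ _ fun x₁ x₂ x₃ x₄ => ?_
    by_cases H : ∃ n, (x₁, x₄) ∉ V n
    · refine (dif_pos H).trans_le ?_
      rw [← div_le_iff₀' zero_lt_two, ← mul_one_div (_ ^ _), ← pow_succ]
      simp only [le_max_iff, hle_d, ← not_and_or]
      rintro ⟨h₁₂, h₂₃, h₃₄⟩
      exact Nat.find_spec H (hV.comp _ ⟨x₃, ⟨x₂, h₁₂, h₂₃⟩, h₃₄⟩)
    · exact (dif_neg H).trans_le zero_le
  have hlt : ∀ x y n, (d x y : ℝ) < (1 / 2) ^ n ↔ (x, y) ∈ V n := by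
    intro x y n
    rw [← not_iff_not, not_lt, ← hle_d, ← NNReal.coe_le_coe]
    simp
  have hU : 𝓤[u] = 𝓤[I.toUniformSpace] := by
    -- The shift to `n + 1` absorbs the factor in `c ≤ 2 * dist`.
    refine (hbasis.ext (Metric.uniformity_basis_dist_pow (r := 1 / 2) (by norm_num) (by norm_num))
      (fun n hn => ⟨n + 1, hn, fun p hp => ?_⟩) fun n hn => ⟨n, hn, fun p hp => ?_⟩)
    · have hp : I.dist p.1 p.2 < (1 / 2) ^ (n + 1) := hp
      refine (hlt p.1 p.2 n).1 ((hd_le _ _).trans_lt ?_)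
      rw [pow_succ] at hp
      linarith
    · exact (hdist_le _ _).trans_lt ((hlt p.1 p.2 n).2 hp)
  let M : MetricSpace X :=
    { I.replaceUniformity hU with
      eq_of_dist_eq_zero := fun {x y} h => hsep x y fun n => (hlt x y n).1 (by
        have h1 := hd_le x y
        have h2 : I.dist x y = 0 := h
        rw [h2, mul_zero] at h1
        exact h1.trans_lt (by positivity)) }
  refine ⟨M, fun x y => d x y, rfl, ⟨fun x y => by rw [hd_symm], hdist_le, hd_le, ?_⟩, hlt⟩
  intro x y hxy
  have H : ∃ n, (x, y) ∉ V n := by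
    by_contra! h
    exact hxy (hsep x y h)
  -- Because `V 0` is everything, the first failure is at some `k + 1`, and `c` is constant on the
  -- open set of pairs in `V k` outside `V (k + 1)`.
  have hpos : Nat.find H ≠ 0 := fun h => by
    have := Nat.find_spec H
    rw [h, hV.zero] at this
    exact this trivial
  obtain ⟨k, hk⟩ := Nat.exists_eq_succ_of_ne_zero hpos
  have h1 : (x, y) ∈ V k := not_not.1 (Nat.find_min H (by omega))
  have h2 : (x, y) ∉ V (k + 1) := by
    have := Nat.find_spec H
    rwa [hk] at this
  have hval : ∀ p : X × X, p ∈ V k → p ∉ V (k + 1) → d p.1 p.2 = (1 / 2) ^ (k + 1) := by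
    intro p hp hp'
    have hp2 : ∃ n, (p.1, p.2) ∉ V n := ⟨k + 1, hp'⟩
    rw [hd]
    refine (dif_pos hp2).trans ?_
    congr 1
    exact (Nat.find_eq_iff hp2).2 ⟨hp', fun n hn => not_not.2 (hanti (by omega : n ≤ k) hp)⟩
  filter_upwards [(hV.clopen k).isOpen.mem_nhds h1,
    (hV.clopen (k + 1)).isClosed.isOpen_compl.mem_nhds h2] with p hp hp'
  rw [hval p hp hp', hval (x, y) h1 h2]

theorem wordSet_eq_gaugeWords {V : ℕ → SetRel X X} {c : X → X → ℝ}
    (h : ∀ x y n, c x y < (1 / 2) ^ n ↔ (x, y) ∈ V n) :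
    (wordSet fun i => V (i ^ 2)) = gaugeWords c := by
  ext n g
  simp only [wordSet, gaugeWords, slotBound, h, pairSum]

theorem IsSubordinate.exists_groupTopology [u : UniformSpace X] {W V : ℕ → SetRel X X}
    (hW : IsClopenUniformBase W) (hV : IsSubordinate W V) :
    ∃ _ : TopologicalSpace (FreeAbelianGroup X),
      IsTopologicalAddGroup (FreeAbelianGroup X) ∧
      (𝓝 (0 : FreeAbelianGroup X)).HasBasis (fun _ : ℕ => True) (wordSet fun i => V (i ^ 2)) ∧
      TopologicalSpace.MetrizableSpace (FreeAbelianGroup X) ∧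
      TopologicalSpace.IsTopologicalBasis {s : Set (FreeAbelianGroup X) | IsClopen s} ∧
      IsClosedEmbedding (FreeAbelianGroup.of : X → FreeAbelianGroup X) := by
  obtain ⟨M, c, rfl, hc, hlt⟩ := hV.exists_gauge hW
  rw [wordSet_eq_gaugeWords hlt]
  exact hc.exists_groupTopology

theorem hasClopenUniformity_of_isEmbedding [t : TopologicalSpace X] {G : Type*} [Group G]
    [TopologicalSpace G] [IsTopologicalGroup G] [TopologicalSpace.MetrizableSpace G]
    (hG : smallInductiveDimension G = 0) {f : X → G} (hf : IsEmbedding f) :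
    HasClopenUniformity X := by
  have hbasis : TopologicalSpace.IsTopologicalBasis {s : Set G | IsClopen s} :=
    hasSmallInductiveDimensionLT_one_iff.1
      ((smallInductiveDimension_le_iff (n := 0)).1 (by simp [hG]))
  obtain ⟨b, hb⟩ := (𝓝 (1 : G)).exists_antitone_basis
  have hC : ∀ n, ∃ C : Set G, IsClopen C ∧ 1 ∈ C ∧ C ⊆ b n := fun n => by
    obtain ⟨C, hC, h1, hCb⟩ := hbasis.mem_nhds_iff.1 (hb.mem n)
    exact ⟨C, hC, h1, hCb⟩
  choose C hCc hC1 hCb using hC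
  -- Intersecting with the inverse makes the entourages symmetric and keeps them clopen.
  have hD : (𝓝 (1 : G)).HasBasis (fun _ : ℕ => True) fun n => C n ∩ (C n)⁻¹ := by
    refine hb.toHasBasis.to_hasBasis
      (fun n _ => ⟨n, trivial, Set.inter_subset_left.trans (hCb n)⟩) fun n _ => ?_
    refine hb.toHasBasis.mem_iff.1 (inter_mem ((hCc n).isOpen.mem_nhds (hC1 n)) ?_)
    exact (hCc n).isOpen.inv.mem_nhds (by simpa using hC1 n)
  let uG := IsTopologicalGroup.leftUniformSpace G
  have hunif : (𝓤 G).HasBasis (fun _ : ℕ => True)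
      fun n => (fun p : G × G => p.1⁻¹ * p.2) ⁻¹' (C n ∩ (C n)⁻¹) := hD.comap _
  let u : UniformSpace X := uG.comap f
  refine ⟨u, hf.eq_induced.symm,
    fun n => (fun p : X × X => (f p.1)⁻¹ * f p.2) ⁻¹' (C n ∩ (C n)⁻¹), ?_⟩
  obtain rfl : t = u.toTopologicalSpace := hf.eq_induced
  have hcont : Continuous fun p : X × X => (f p.1)⁻¹ * f p.2 :=
    (hf.continuous.comp continuous_fst).inv.mul (hf.continuous.comp continuous_snd)
  refine ⟨hunif.comap _, fun x y h => hf.injective ?_, fun n => ⟨fun x y h => ?_⟩, fun n =>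
    ((hCc n).inter ((hCc n).preimage continuous_inv)).preimage hcont⟩
  · have h1 : (f x)⁻¹ * f y ∈ (𝓝 (1 : G)).ker := by
      rw [hD.ker]
      simpa using h
    rw [ker_nhds, Set.mem_singleton_iff, inv_mul_eq_one] at h1
    exact h1
  · simpa [and_comm] using h

end Uniform

theorem theorem1p1 (X : Type u) [t : TopologicalSpace X] :
    -- the criterion
    ((∃ (G : Type u) (_ : Group G) (_ : TopologicalSpace G),
        IsTopologicalGroup G ∧ TopologicalSpace.MetrizableSpace G ∧
        smallInductiveDimension G = 0 ∧ ∃ f : X → G, IsEmbedding f) ↔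
      HasClopenUniformity X) ∧
    -- the group topology on the free Abelian group
    (∀ u : UniformSpace X, u.toTopologicalSpace = t →
      ∀ W : ℕ → SetRel X X, @IsClopenUniformBase X u W →
        (∃ V : ℕ → SetRel X X, @IsSubordinate X u W V) ∧
        ∀ V : ℕ → SetRel X X, @IsSubordinate X u W V →
          ∃ _ : TopologicalSpace (FreeAbelianGroup X),
            IsTopologicalAddGroup (FreeAbelianGroup X) ∧
            (𝓝 (0 : FreeAbelianGroup X)).HasBasis (fun _ : ℕ => True)
              (wordSet fun i => V (i ^ 2)) ∧
            TopologicalSpace.MetrizableSpace (FreeAbelianGroup X) ∧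
            TopologicalSpace.IsTopologicalBasis
              {s : Set (FreeAbelianGroup X) | IsClopen s} ∧
            smallInductiveDimension (FreeAbelianGroup X) = 0 ∧
            @IsClosedEmbedding X (FreeAbelianGroup X) t _ FreeAbelianGroup.of) := by
  refine ⟨⟨?_, ?_⟩, ?_⟩
  · rintro ⟨G, _, _, _, _, hG, f, hf⟩
    exact hasClopenUniformity_of_isEmbedding hG hf
  · rintro ⟨u, rfl, W, hW⟩
    obtain ⟨V, hV⟩ := hW.exists_subordinate
    obtain ⟨τ, hgrp, -, hmetr, hbasis, hof⟩ := hV.exists_groupTopology hW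
    refine ⟨Multiplicative (FreeAbelianGroup X), inferInstance, inferInstance, inferInstance,
      hmetr, ?_, fun x => Multiplicative.ofAdd (FreeAbelianGroup.of x), hof.isEmbedding⟩
    exact smallInductiveDimension_eq_zero_of_clopen (Y := Multiplicative (FreeAbelianGroup X))
      hbasis
  · rintro u rfl W hW
    refine ⟨hW.exists_subordinate, fun V hV => ?_⟩
    obtain ⟨τ, hgrp, h0, hmetr, hbasis, hof⟩ := hV.exists_groupTopology hW
    exact ⟨τ, hgrp, h0, hmetr, hbasis, smallInductiveDimension_eq_zero_of_clopen hbasis, hof⟩
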